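/- Let $k\ge 3$ and $n_0\ge 2$ be integers and let $c>0$ and $K$ be real numbers. Write $[n]=\{1,\dots,n\}$; a set of integers is $k$-AP-free if it contains no arithmetic progression $a,a+d,\dots,a+(k-1)d$ with $d\ge 1$, and $r_k(n)$ is the maximum size of a $k$-AP-free subset of $[n]$. Call a function $h$ admissible if for all integers $n\ge n_0$ $$h(n)>0,\qquad r_k(n)\le \frac{n}{h(n)},\qquad h(n)\le(\log_2 n)^c,$$ and $h(n)\le K\,h(\lfloor\sqrt n\rfloor)$ whenever $\lfloor\sqrt n\rfloor\ge n_0$ (this holds, for example with $K=3^c$, whenever $h(n)/(\log_2 n)^c$ is non-increasing for $n\ge n_0$). 1. There is a constant $C=C(k,c,K,n_0)>0$ such that for every admissible $h$ and every $n\ge n_0$, the number of $k$-AP-free subsets of $[n]$ is at most $2^{C n/h(n)}$. 2. For every $\gamma>0$ there is a constant $C=C(k,c,K,n_0,\gamma)>0$ such that for every admissible $h$, every $n\ge n_0$ and every integer $m\ge n^{1-\frac1{k-1}+\gamma}$, the number of $k$-AP-free $m$-element subsets of $[n]$ is at most $\binom{\lfloor Cn/h(n)\rfloor}{m}$. -/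

import Mathlib

/-- `A` contains no `k`-term arithmetic progression `a, a + d, …, a + (k - 1) d` with `d ≥ 1`. -/
def IsAPFree (k : ℕ) (A : Finset ℕ) : Prop :=
  ¬ ∃ a d : ℕ, 0 < d ∧ ∀ i < k, a + i * d ∈ A

open Classical in
/-- The family of all `k`-AP-free subsets of `[n] = {1, …, n}`. -/
noncomputable def apFreeSets (k n : ℕ) : Finset (Finset ℕ) :=
  (Finset.Icc 1 n).powerset.filter (IsAPFree k)

/-- `r_k(n)`: the maximum size of a `k`-AP-free subset of `[n]`. -/
noncomputable def maxAPFree (k n : ℕ) : ℕ :=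
  (apFreeSets k n).sup Finset.card

/-- `h` is a positive function on the integers `n ≥ n₀` such that `r_k(n) ≤ n / h(n)` and
`h(n) ≤ (log₂ n) ^ c`, and whose growth is regular: `h(n) ≤ K * h(⌊√n⌋)` whenever `⌊√n⌋ ≥ n₀`. -/
structure IsDensityRate (k : ℕ) (c K : ℝ) (n₀ : ℕ) (h : ℕ → ℝ) : Prop where
  pos : ∀ n, n₀ ≤ n → 0 < h n
  maxAPFree_le : ∀ n, n₀ ≤ n → (maxAPFree k n : ℝ) ≤ (n : ℝ) / h n
  le_log_rpow : ∀ n, n₀ ≤ n → h n ≤ (Real.logb 2 (n : ℝ)) ^ c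
  regular : ∀ n, n₀ ≤ Nat.sqrt n → h n ≤ K * h (Nat.sqrt n)

/-! The proof combines supersaturation with a container argument. Supersaturation
(`card_mul_le_card_apEdges`, `IsDensityRate.card_apEdges_ge`): let `M` be a `t`-fold iterated square
root of `n`, so `M ≤ n ^ ε` while regularity keeps `h M` within a constant factor of `h n`. If `|A|`
exceeds a large multiple of `n / h n`, then many `M`-term progressions meet `A` in more than
`r_k(M)` positions and so contain a `k`-AP of `A`. Each `k`-AP is counted at most `M ^ 2` times, so
`A` contains nearly `n ^ 2` of them, up to a small power of `n`. Containers (`covered_of_branch`,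
`covered_of_edges`): two terms at known positions determine a progression. Given many edges `F`,
either `I` misses the set `D` of vertices of high degree in position `j`, and `D` can be deleted
from the container, or `I` contains some `v ∈ D`, and edges through `v` are recorded in `G`. Once
`G` is large it replaces `F` at stage `j - 1`. At stage `0` all later vertices of each edge lie in
`I`, so `I` misses every first vertex. Iterating until supersaturation fails leaves at most `2 ^ m`
containers of size `O(n / h n)`; counting subsets of containers gives both bounds. -/

open Finset

/-! ### Covering families -/

/-- Every set satisfying `P` lies in one of at most `B` sets, each of size at most `t`. -/
def Covered {V : Type*} (P : Finset V → Prop) (B : ℕ) (t : ℝ) : Prop :=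
  ∃ 𝒞 : Finset (Finset V), 𝒞.card ≤ B ∧ (∀ C ∈ 𝒞, (C.card : ℝ) ≤ t) ∧
    ∀ I, P I → ∃ C ∈ 𝒞, I ⊆ C

theorem Covered.mono {V : Type*} {P Q : Finset V → Prop} {B B' : ℕ} {t t' : ℝ}
    (h : Covered P B t) (hQ : ∀ I, Q I → P I) (hB : B ≤ B') (ht : t ≤ t') : Covered Q B' t' := by
  obtain ⟨𝒞, h1, h2, h3⟩ := h
  exact ⟨𝒞, h1.trans hB, fun C hC => (h2 C hC).trans ht, fun I hI => h3 I (hQ I hI)⟩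

theorem Covered.singleton {V : Type*} {P : Finset V → Prop} {t : ℝ} (C : Finset V)
    (hC : (C.card : ℝ) ≤ t) (h : ∀ I, P I → I ⊆ C) : Covered P 1 t :=
  ⟨{C}, by simp, by simpa using hC, fun I hI => ⟨C, by simp, h I hI⟩⟩

theorem Covered.or {V : Type*} [DecidableEq V] {P Q : Finset V → Prop} {B B' : ℕ} {t : ℝ}
    (hP : Covered P B t) (hQ : Covered Q B' t) : Covered (fun I => P I ∨ Q I) (B + B') t := by
  obtain ⟨𝒞, h1, h2, h3⟩ := hP
  obtain ⟨𝒟, k1, k2, k3⟩ := hQ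
  refine ⟨𝒞 ∪ 𝒟, (card_union_le _ _).trans (by omega), fun C hC => ?_, fun I hI => ?_⟩
  · rcases mem_union.1 hC with h | h
    exacts [h2 C h, k2 C h]
  · rcases hI with h | h
    · obtain ⟨C, hC, hIC⟩ := h3 I h
      exact ⟨C, mem_union_left _ hC, hIC⟩
    · obtain ⟨C, hC, hIC⟩ := k3 I h
      exact ⟨C, mem_union_right _ hC, hIC⟩

theorem Covered.biUnion {V ι : Type*} [DecidableEq V] {P : ι → Finset V → Prop} {B : ℕ} {t : ℝ}
    (s : Finset ι) (h : ∀ v ∈ s, Covered (P v) B t) :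
    Covered (fun I => ∃ v ∈ s, P v I) (s.card * B) t := by
  choose! 𝒞 h1 h2 h3 using h
  refine ⟨s.biUnion 𝒞, card_biUnion_le_card_mul _ _ _ h1, fun C hC => ?_, fun I hI => ?_⟩
  · obtain ⟨v, hv, hC⟩ := mem_biUnion.1 hC
    exact h2 v hv C hC
  · obtain ⟨v, hv, hI⟩ := hI
    obtain ⟨C, hC, hIC⟩ := h3 v hv I hI
    exact ⟨C, mem_biUnion.2 ⟨v, hv, hC⟩, hIC⟩

/-! ### Degrees and the container algorithm -/

/-- The number of edges in `F` whose vertex under the coordinate map `f` is `u`. -/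
def coordDegree {V ε : Type*} [DecidableEq V] (f : ε → V) (F : Finset ε) (u : V) : ℕ :=
  (F.filter (fun e => f e = u)).card

section Degree

variable {V ε : Type*} [DecidableEq V]

theorem coordDegree_mono (f : ε → V) {F G : Finset ε} (h : G ⊆ F) (u : V) :
    coordDegree f G u ≤ coordDegree f F u :=
  card_le_card (filter_subset_filter _ h)

theorem sum_coordDegree (f : ε → V) (F : Finset ε) (S : Finset V) :
    ∑ u ∈ S, coordDegree f F u = (F.filter (fun e => f e ∈ S)).card := by
  rw [card_eq_sum_card_fiberwise (f := f) (s := F.filter (fun e => f e ∈ S)) (t := S)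
    (fun e he => (mem_filter.1 he).2)]
  refine sum_congr rfl fun u hu => ?_
  unfold coordDegree
  congr 1
  ext e
  simp only [mem_filter]
  constructor
  · rintro ⟨h1, h2⟩
    exact ⟨⟨h1, h2 ▸ hu⟩, h2⟩
  · rintro ⟨⟨h1, -⟩, h2⟩
    exact ⟨h1, h2⟩

theorem card_filter_mem_le (f : ε → V) (F : Finset ε) (S : Finset V) {Δ : ℕ}
    (h : ∀ u, coordDegree f F u ≤ Δ) : (F.filter (fun e => f e ∈ S)).card ≤ S.card * Δ := by
  rw [← sum_coordDegree, ← smul_eq_mul]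
  exact sum_le_card_nsmul _ _ _ fun u _ => h u

theorem card_le_card_mul_degree (f : ε → V) (F : Finset ε) (A : Finset V) {Δ : ℕ}
    (hA : ∀ e ∈ F, f e ∈ A) (h : ∀ u, coordDegree f F u ≤ Δ) : F.card ≤ A.card * Δ := by
  have := card_filter_mem_le f F A h
  rwa [filter_true_of_mem hA] at this

/-- The edges of `F` outside `G` none of whose first `j` vertices has degree `Δ'` in `G`. -/
def unsaturated [DecidableEq ε] (x : ℕ → ε → V) (j Δ' : ℕ) (F G : Finset ε) : Finset ε :=
  (F \ G).filter (fun e => ∀ i < j, coordDegree (x i) G (x i e) < Δ')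

/-- Stopping rule: more than half of `F` lies in `G` or meets a saturated vertex. Each position has
at most `|G| / Δ'` saturated vertices, each on at most `Δ` edges of `F`, so `G` is already large. -/
theorem card_le_of_unsaturated_lt [DecidableEq ε] (x : ℕ → ε → V) (j Δ Δ' : ℕ) (F G : Finset ε)
    (A : Finset V) (hA : ∀ e ∈ F, ∀ i ≤ j, x i e ∈ A) (hΔ : Δ' ≤ Δ)
    (hF : ∀ i ≤ j, ∀ u, coordDegree (x i) F u ≤ Δ)
    (hlt : 2 * (unsaturated x j Δ' F G).card < F.card) :
    F.card * Δ' ≤ 2 * (j + 1) * Δ * G.card := by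
  classical
  set S : ℕ → Finset V := fun i => A.filter (fun u => Δ' ≤ coordDegree (x i) G u) with hS
  have hSc : ∀ i, (S i).card * Δ' ≤ G.card := fun i => by
    calc (S i).card * Δ' ≤ ∑ u ∈ S i, coordDegree (x i) G u := by
          rw [← smul_eq_mul]
          exact card_nsmul_le_sum _ _ _ fun u hu => (mem_filter.1 hu).2
      _ ≤ G.card := by rw [sum_coordDegree]; exact card_filter_le _ _
  have hcov : F ⊆ unsaturated x j Δ' F G ∪ (G ∪ (range j).biUnion
      fun i => F.filter (fun e => x i e ∈ S i)) := by
    intro e he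
    by_cases heG : e ∈ G
    · simp [heG]
    by_cases hu : ∀ i < j, coordDegree (x i) G (x i e) < Δ'
    · exact mem_union_left _ (mem_filter.2 ⟨mem_sdiff.2 ⟨he, heG⟩, hu⟩)
    · push Not at hu
      obtain ⟨i, hi, hi'⟩ := hu
      refine mem_union_right _ (mem_union_right _ (mem_biUnion.2 ⟨i, mem_range.2 hi, ?_⟩))
      exact mem_filter.2 ⟨he, mem_filter.2 ⟨hA e he i hi.le, hi'⟩⟩
  have h1 : F.card ≤ (unsaturated x j Δ' F G).card +
      (G.card + ∑ i ∈ range j, (S i).card * Δ) := by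
    refine (card_le_card hcov).trans ((card_union_le _ _).trans ?_)
    gcongr
    refine (card_union_le _ _).trans ?_
    gcongr
    refine card_biUnion_le.trans (sum_le_sum fun i hi => ?_)
    exact card_filter_mem_le _ _ _ (hF i (mem_range.1 hi).le)
  have h2 : (∑ i ∈ range j, (S i).card * Δ) * Δ' ≤ j * (Δ * G.card) := by
    rw [sum_mul]
    calc ∑ i ∈ range j, (S i).card * Δ * Δ' ≤ ∑ i ∈ range j, Δ * G.card := by
          refine sum_le_sum fun i _ => ?_
          calc (S i).card * Δ * Δ' = Δ * ((S i).card * Δ') := by ring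
            _ ≤ _ := Nat.mul_le_mul_left _ (hSc i)
      _ = _ := by simp
  have h3 : F.card ≤ 2 * (G.card + ∑ i ∈ range j, (S i).card * Δ) := by omega
  calc F.card * Δ' ≤ 2 * (G.card + ∑ i ∈ range j, (S i).card * Δ) * Δ' :=
        Nat.mul_le_mul_right _ h3
    _ = 2 * (G.card * Δ' + (∑ i ∈ range j, (S i).card * Δ) * Δ') := by ring
    _ ≤ 2 * (G.card * Δ + j * (Δ * G.card)) := by gcongr
    _ = _ := by ring

/-- Low-degree vertices carry at most `n * |F| / (4 * n)` edges, so at least `|F| / 4` edges of `F'`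
remain for the others, each carrying at most `Δ`. -/
theorem card_le_high_degree (f : ε → V) (F F' : Finset ε) (A : Finset V) (n Δ : ℕ)
    (hn : 0 < n) (hAn : A.card ≤ n) (hA : ∀ e ∈ F', f e ∈ A)
    (hΔ : ∀ u, coordDegree f F' u ≤ Δ) (hF : F.card ≤ 2 * F'.card) :
    F.card ≤ 4 * Δ * (A.filter (fun v => F.card ≤ 4 * n * coordDegree f F' v)).card := by
  classical
  set D := A.filter (fun v => F.card ≤ 4 * n * coordDegree f F' v)
  set D' := A.filter (fun v => ¬ F.card ≤ 4 * n * coordDegree f F' v)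
  have h1 : F'.card = ∑ v ∈ D, coordDegree f F' v + ∑ v ∈ D', coordDegree f F' v := by
    rw [sum_filter_add_sum_filter_not, sum_coordDegree, filter_true_of_mem hA]
  have h2 : ∑ v ∈ D, coordDegree f F' v ≤ D.card * Δ := by
    rw [← smul_eq_mul]
    exact sum_le_card_nsmul _ _ _ fun u _ => hΔ u
  have h3 : 4 * n * ∑ v ∈ D', coordDegree f F' v ≤ n * F.card := by
    rw [mul_sum]
    calc _ ≤ ∑ v ∈ D', F.card :=
          sum_le_sum fun v hv => (not_le.1 (mem_filter.1 hv).2).le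
      _ = D'.card * F.card := by simp
      _ ≤ _ := Nat.mul_le_mul_right _ ((card_filter_le _ _).trans hAn)
  have h4 : 4 * ∑ v ∈ D', coordDegree f F' v ≤ F.card := by
    refine Nat.le_of_mul_le_mul_left ?_ hn
    linarith
  nlinarith

variable [DecidableEq ε]

/-- One stage of the container algorithm: it trades the edges `F` for a set `G` of edges whose
`j`-th vertex lies in the sets to be covered. -/
theorem covered_of_branch (x : ℕ → ε → V) (j : ℕ) (hj : 0 < j)
    (hlin : ∀ i < j, ∀ e e', x i e = x i e' → x j e = x j e' → e = e')
    (A : Finset V) (F : Finset ε) (hA : ∀ e ∈ F, ∀ i ≤ j, x i e ∈ A)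
    (n Δ Δ' : ℕ) (hn : 0 < n) (hAn : A.card ≤ n) (hΔ' : 0 < Δ') (hΔ : Δ' ≤ Δ)
    (hF : ∀ i ≤ j, ∀ u, coordDegree (x i) F u ≤ Δ)
    (P : Finset V → Prop) (hP : ∀ I, P I → I ⊆ A) (B : ℕ) (hB : 1 ≤ B) (t : ℝ)
    (ht : (A.card : ℝ) - F.card / (4 * Δ) ≤ t)
    (hgood : ∀ G ⊆ F, (∀ i < j, ∀ u, coordDegree (x i) G u ≤ Δ') →
      F.card * Δ' ≤ 2 * (j + 1) * Δ * G.card →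
      Covered (fun I => P I ∧ ∀ e ∈ G, x j e ∈ I) B t)
    (r : ℕ) (G : Finset ε) (hGF : G ⊆ F) (hG : ∀ i < j, ∀ u, coordDegree (x i) G u ≤ Δ')
    (hr : 4 * n * (n * Δ') < 4 * n * G.card + r * F.card) :
    Covered (fun I => P I ∧ ∀ e ∈ G, x j e ∈ I) ((n + 1) ^ r * B) t := by
  induction r generalizing G with
  | zero =>
    -- The budget `r` cannot run out: `G` would exceed its maximal size `n * Δ'`.
    exfalso
    have h1 : G.card ≤ A.card * Δ' :=
      card_le_card_mul_degree (x 0) G A (fun e he => hA e (hGF he) 0 (Nat.zero_le _)) (hG 0 hj)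
    have h2 : G.card ≤ n * Δ' := h1.trans (Nat.mul_le_mul_right _ hAn)
    have := Nat.mul_le_mul_left (4 * n) h2
    omega
  | succ r ih =>
    set F' := unsaturated x j Δ' F G with hF'
    by_cases hlt : 2 * F'.card < F.card
    · refine (hgood G hGF hG
        (card_le_of_unsaturated_lt x j Δ Δ' F G A hA hΔ hF hlt)).mono (fun _ h => h) ?_ le_rfl
      exact Nat.le_mul_of_pos_left _ (by positivity)
    push Not at hlt
    have hF'F : F' ⊆ F := (filter_subset _ _).trans sdiff_subset
    set D := A.filter (fun v => F.card ≤ 4 * n * coordDegree (x j) F' v) with hD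
    have hDc : F.card ≤ 4 * Δ * D.card :=
      card_le_high_degree (x j) F F' A n Δ hn hAn (fun e he => hA e (hF'F he) j le_rfl)
        (fun u => (coordDegree_mono _ hF'F u).trans (hF j le_rfl u)) hlt
    have hc1 : Covered (fun I => P I ∧ Disjoint I D) 1 t := by
      refine Covered.singleton (A \ D) ?_ fun I hI v hv =>
        mem_sdiff.2 ⟨hP I hI.1 hv, fun hvD => disjoint_left.1 hI.2 hv hvD⟩
      rw [cast_card_sdiff (filter_subset _ _)]
      refine le_trans (sub_le_sub_left ?_ _) ht
      rw [div_le_iff₀ (by have := hΔ'.trans_le hΔ; positivity)]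
      calc (F.card : ℝ) ≤ ((4 * Δ * D.card : ℕ) : ℝ) := by exact_mod_cast hDc
        _ = _ := by push_cast; ring
    have hc2 : ∀ v ∈ D, Covered (fun I => (P I ∧ ∀ e ∈ G, x j e ∈ I) ∧ v ∈ I)
        ((n + 1) ^ r * B) t := by
      intro v hv
      set L := F'.filter (fun e => x j e = v) with hL
      have hdisj : Disjoint G L := disjoint_left.2 fun e he heL =>
        (mem_sdiff.1 (mem_filter.1 (mem_filter.1 heL).1).1).2 he
      refine (ih (G ∪ L) (union_subset hGF ((filter_subset _ _).trans hF'F)) ?_ ?_).mono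
        ?_ le_rfl le_rfl
      -- By linearity `L` adds at most one edge at `u`, and only if `u` was unsaturated, so the
      -- degree stays at most `Δ'`.
      · intro i hi u
        unfold coordDegree
        rw [filter_union]
        refine (card_union_le _ _).trans ?_
        rcases (L.filter (fun e => x i e = u)).eq_empty_or_nonempty with h0 | ⟨e, he⟩
        · rw [h0]
          exact hG i hi u
        · have h1 : (L.filter (fun e => x i e = u)).card ≤ 1 := by
            refine card_le_one.2 fun e he e' he' => ?_
            simp only [hL, mem_filter] at he he'
            exact hlin i hi e e' (he.2.trans he'.2.symm) (he.1.2.trans he'.1.2.symm)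
          have h2 : coordDegree (x i) G u < Δ' := by
            obtain ⟨heL, heu⟩ := mem_filter.1 he
            have := (mem_filter.1 (mem_filter.1 heL).1).2 i hi
            rwa [heu] at this
          unfold coordDegree at h2
          omega
      · have hLc : F.card ≤ 4 * n * L.card := (mem_filter.1 hv).2
        rw [card_union_of_disjoint hdisj]
        rw [add_mul] at hr
        linarith
      · rintro I ⟨⟨hI, hIG⟩, hvI⟩
        refine ⟨hI, fun e he => ?_⟩
        rcases mem_union.1 he with h | h
        · exact hIG e h
        · rw [(mem_filter.1 h).2]
          exact hvI
    refine (hc1.or (Covered.biUnion D hc2)).mono ?_ ?_ le_rfl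
    · rintro I ⟨hI, hIG⟩
      by_cases hd : Disjoint I D
      · exact Or.inl ⟨hI, hd⟩
      · obtain ⟨v, hvI, hvD⟩ := not_disjoint_iff.1 hd
        exact Or.inr ⟨v, hvD, ⟨hI, hIG⟩, hvI⟩
    · have h1 : D.card ≤ n := (card_filter_le _ _).trans hAn
      have h2 : 1 ≤ (n + 1) ^ r * B := Nat.mul_pos (by positivity) hB
      calc 1 + D.card * ((n + 1) ^ r * B)
          ≤ (n + 1) ^ r * B + n * ((n + 1) ^ r * B) := by gcongr
        _ = _ := by ring

end Degree

/-- Container lemma for `k`-partite linear hypergraphs, run from stage `j` down to stage `0`. -/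
theorem covered_of_edges {V ε : Type*} [DecidableEq V] [DecidableEq ε] (x : ℕ → ε → V) (k : ℕ)
    (hk : 2 ≤ k) (hlin : ∀ i j, i < j → ∀ e e', x i e = x i e' → x j e = x j e' → e = e')
    (A : Finset V) (n : ℕ) (hn : 0 < n) (hAn : A.card ≤ n) (Δ : ℕ → ℕ) (hΔ0 : ∀ j, 0 < Δ j)
    (hΔ : Monotone Δ) (P : Finset V → Prop) (hP : ∀ I, P I → I ⊆ A) (E : Finset ε)
    (hE : ∀ e ∈ E, ∀ i < k, x i e ∈ A)
    (hind : ∀ I, P I → ∀ e ∈ E, ∃ i < k, x i e ∉ I) (b : ℝ) (hb : 0 < b)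
    (r : ℕ) (hr : ∀ j, 4 * (n : ℝ) * Δ j < r * b * Δ (j + 1))
    (j : ℕ) (hj : j < k) (F : Finset ε) (hFE : F ⊆ E)
    (hF : ∀ i ≤ j, ∀ u, coordDegree (x i) F u ≤ Δ j)
    (hcard : b * (2 * k) ^ j * n * Δ j ≤ F.card) :
    Covered (fun I => P I ∧ ∀ e ∈ F, ∀ i, j < i → i < k → x i e ∈ I)
      (((n + 1) ^ r) ^ j) (A.card - b * n) := by
  induction j generalizing F with
  | zero =>
    rw [pow_zero]
    have hsub : F.image (x 0) ⊆ A := by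
      intro v hv
      obtain ⟨e, he, rfl⟩ := mem_image.1 hv
      exact hE e (hFE he) 0 hj
    refine Covered.singleton (A \ F.image (x 0)) ?_ ?_
    · rw [cast_card_sdiff hsub]
      have h1 : F.card ≤ (F.image (x 0)).card * Δ 0 :=
        card_le_card_mul_degree (x 0) F _ (fun e he => mem_image_of_mem _ he) (hF 0 le_rfl)
      have h2 : b * n * Δ 0 ≤ (F.image (x 0)).card * Δ 0 := by
        calc b * n * Δ 0 = b * (2 * k) ^ 0 * n * Δ 0 := by ring
          _ ≤ F.card := hcard
          _ ≤ _ := by exact_mod_cast h1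
      have h3 : b * n ≤ (F.image (x 0)).card :=
        le_of_mul_le_mul_right h2 (by exact_mod_cast hΔ0 0)
      linarith
    · rintro I ⟨hI, hIF⟩ v hv
      refine mem_sdiff.2 ⟨hP I hI hv, fun hv' => ?_⟩
      obtain ⟨e, he, rfl⟩ := mem_image.1 hv'
      obtain ⟨i, hi, hi'⟩ := hind I hI e (hFE he)
      rcases Nat.eq_zero_or_pos i with rfl | h0
      · exact hi' hv
      · exact hi' (hIF e he i h0 hi)
  | succ j ih =>
    have hΔR : (0 : ℝ) < Δ (j + 1) := by exact_mod_cast hΔ0 (j + 1)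
    have hΔR' : (0 : ℝ) < Δ j := by exact_mod_cast hΔ0 j
    have hnR : (0 : ℝ) < n := by exact_mod_cast hn
    have hkR : (2 : ℝ) ≤ k := by exact_mod_cast hk
    have h1k : (1 : ℝ) ≤ (2 * k) ^ j := one_le_pow₀ (by linarith)
    have hcard' : b * n * Δ (j + 1) * 4 ≤ F.card := by
      refine le_trans ?_ hcard
      have : (4 : ℝ) ≤ (2 * k) ^ (j + 1) := by
        rw [pow_succ]
        nlinarith
      calc b * n * Δ (j + 1) * 4 ≤ b * n * Δ (j + 1) * (2 * k) ^ (j + 1) := by gcongr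
        _ = _ := by ring
    have key := covered_of_branch x (j + 1) (Nat.succ_pos _) (fun i hi => hlin i (j + 1) hi) A F
      (fun e he i hi => hE e (hFE he) i (by omega)) n (Δ (j + 1)) (Δ j) hn hAn (hΔ0 j)
      (hΔ (Nat.le_succ _)) hF
      (fun I => P I ∧ ∀ e ∈ F, ∀ i, j + 1 < i → i < k → x i e ∈ I) (fun I hI => hP I hI.1)
      (((n + 1) ^ r) ^ j) (Nat.one_le_pow _ _ (by positivity)) (A.card - b * n) ?_ ?_ r ∅
      (empty_subset _) (by simp [coordDegree]) ?_
    · refine key.mono (fun I hI => ⟨hI, by simp⟩) (le_of_eq ?_) le_rfl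
      rw [pow_succ, mul_comm]
    · refine sub_le_sub_left ?_ _
      rw [le_div_iff₀ (by positivity)]
      linarith
    · intro G hGF hG hGc
      refine (ih (by omega) G (hGF.trans hFE) (fun i hi => hG i (by omega)) ?_).mono ?_ le_rfl
        le_rfl
      -- Descending one stage costs a factor `2 * k` in density relative to `n * Δ j`; this is what
      -- `(2 * k) ^ j` in `hcard` pays for.
      · have h1 : (F.card : ℝ) * Δ j ≤ 2 * ((j + 1 : ℕ) + 1) * Δ (j + 1) * G.card := by
          exact_mod_cast hGc
        have h2 : ((j + 1 : ℕ) + 1 : ℝ) ≤ k := by exact_mod_cast hj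
        have h3 : (F.card : ℝ) * Δ j ≤ 2 * k * Δ (j + 1) * G.card := by
          refine h1.trans ?_
          gcongr
        have h4 : (b * (2 * k) ^ j * n * Δ j) * (2 * k * Δ (j + 1)) ≤
            G.card * (2 * k * Δ (j + 1)) := by
          calc _ = (b * (2 * k) ^ (j + 1) * n * Δ (j + 1)) * Δ j := by ring
            _ ≤ F.card * Δ j := by gcongr
            _ ≤ _ := h3
            _ = _ := by ring
        exact le_of_mul_le_mul_right h4 (by positivity)
      · rintro I ⟨⟨hI, hIF⟩, hIG⟩
        refine ⟨hI, fun e he i hi hik => ?_⟩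
        rcases Nat.lt_or_ge (j + 1) i with h | h
        · exact hIF e (hGF he) i h hik
        · obtain rfl : i = j + 1 := by omega
          exact hIG e he
    · rw [card_empty, mul_zero, zero_add]
      have h1 := hr j
      have h2 : (4 * n * (n * Δ j) : ℝ) < r * F.card := by
        calc (4 * n * (n * Δ j) : ℝ) = (4 * n * Δ j) * n := by ring
          _ < (r * b * Δ (j + 1)) * n := by gcongr
          _ = r * (b * n * Δ (j + 1) * 1) := by ring
          _ ≤ r * (b * n * Δ (j + 1) * 4) := by gcongr; norm_num
          _ ≤ _ := by gcongr
      exact_mod_cast h2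

/-! ### Containers for progression-free sets -/

/-- The `k`-term arithmetic progressions in `A ⊆ [n]`, recorded as pairs (first term, difference). -/
def apEdges (k n : ℕ) (A : Finset ℕ) : Finset (ℕ × ℕ) :=
  (range (n + 1) ×ˢ Icc 1 n).filter (fun e => ∀ i < k, e.1 + i * e.2 ∈ A)

theorem coordDegree_apEdges_le (k n : ℕ) (A : Finset ℕ) (i u : ℕ) :
    coordDegree (fun e : ℕ × ℕ => e.1 + i * e.2) (apEdges k n A) u ≤ n := by
  unfold coordDegree
  calc _ ≤ (Icc 1 n).card := by
        refine card_le_card_of_injOn Prod.snd ?_ ?_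
        · intro e he
          exact (mem_product.1 (mem_filter.1 (mem_filter.1 he).1).1).2
        · intro e he e' he' h
          have h1 := (mem_filter.1 he).2
          have h2 := (mem_filter.1 he').2
          simp only at h h1 h2
          rw [h] at h1
          exact Prod.ext (by omega) h
    _ = n := by simp

theorem covered_apFree (k n : ℕ) (hk : 2 ≤ k) (hn : 0 < n) (A : Finset ℕ) (hA : A ⊆ Icc 1 n)
    (b : ℝ) (hb : 0 < b) (hcard : b * (2 * k) ^ (k - 1) * n * n ≤ (apEdges k n A).card)
    (r : ℕ) (hr : 8 * (n : ℝ) ^ (1 - 1 / ((k : ℝ) - 1)) < r * b) :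
    Covered (fun I => IsAPFree k I ∧ I ⊆ A) ((n + 1) ^ (r * (k - 1))) (A.card - b * n) := by
  have hk1 : (0 : ℝ) < (k : ℝ) - 1 := by
    have : (2 : ℝ) ≤ k := by exact_mod_cast hk
    linarith
  have hn1 : (1 : ℝ) ≤ n := by exact_mod_cast hn
  have hn0 : (0 : ℝ) < n := by linarith
  -- Geometric interpolation from `1` to the trivial degree bound `n`: each stage then has the same
  -- branching cost, of order `n ^ (1 - 1 / (k - 1)) / b`.
  set Δ : ℕ → ℕ := fun j => ⌈(n : ℝ) ^ ((j : ℝ) / ((k : ℝ) - 1))⌉₊ with hΔ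
  have hone : ∀ j : ℕ, (1 : ℝ) ≤ (n : ℝ) ^ ((j : ℝ) / ((k : ℝ) - 1)) := fun j =>
    Real.one_le_rpow hn1 (by positivity)
  have hlast : Δ (k - 1) = n := by
    simp only [hΔ]
    rw [Nat.cast_sub (by omega), Nat.cast_one, div_self hk1.ne', Real.rpow_one, Nat.ceil_natCast]
  have key := covered_of_edges (fun i (e : ℕ × ℕ) => e.1 + i * e.2) k hk ?_ A n hn
    ((card_le_card hA).trans (by simp)) Δ ?_ ?_ (fun I => IsAPFree k I ∧ I ⊆ A)
    (fun I hI => hI.2) (apEdges k n A) ?_ ?_ b hb r ?_ (k - 1) (by omega) (apEdges k n A)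
    subset_rfl ?_ ?_
  · rw [← pow_mul] at key
    exact key.mono (fun I hI => ⟨hI, fun e _ i h1 h2 => by omega⟩) le_rfl le_rfl
  · rintro i j hij ⟨a, d⟩ ⟨a', d'⟩ h1 h2
    simp only at h1 h2
    obtain ⟨l, rfl⟩ := Nat.exists_eq_add_of_lt hij
    have h3 : (l + 1) * d = (l + 1) * d' := by
      have e1 : (i + l + 1) * d = i * d + (l + 1) * d := by ring
      have e2 : (i + l + 1) * d' = i * d' + (l + 1) * d' := by ring
      omega
    have h4 : d = d' := Nat.eq_of_mul_eq_mul_left (Nat.succ_pos l) h3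
    subst h4
    exact Prod.ext (by simpa using h1) rfl
  · intro j
    exact Nat.ceil_pos.2 (by have := hone j; linarith)
  · intro i j hij
    refine Nat.ceil_mono (Real.rpow_le_rpow_of_exponent_le hn1 ?_)
    gcongr
  · intro e he i hi
    exact (mem_filter.1 he).2 i hi
  · rintro I ⟨hI, -⟩ e he
    by_contra hcon
    push Not at hcon
    exact hI ⟨e.1, e.2, (mem_Icc.1 (mem_product.1 (mem_filter.1 he).1).2).1, hcon⟩
  · intro j
    have h1 : (Δ j : ℝ) ≤ 2 * (n : ℝ) ^ ((j : ℝ) / ((k : ℝ) - 1)) := by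
      have := Nat.ceil_lt_add_one (zero_le_one.trans (hone j))
      have := hone j
      simp only [hΔ]
      linarith
    have h2 : (n : ℝ) ^ (((j + 1 : ℕ) : ℝ) / ((k : ℝ) - 1)) ≤ Δ (j + 1) := Nat.le_ceil _
    calc 4 * (n : ℝ) * Δ j ≤ 4 * n * (2 * (n : ℝ) ^ ((j : ℝ) / ((k : ℝ) - 1))) := by gcongr
      _ = 8 * ((n : ℝ) ^ (1 : ℝ) * (n : ℝ) ^ ((j : ℝ) / ((k : ℝ) - 1))) := by
          rw [Real.rpow_one]; ring
      _ = 8 * (n : ℝ) ^ (1 - 1 / ((k : ℝ) - 1)) *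
            (n : ℝ) ^ (((j + 1 : ℕ) : ℝ) / ((k : ℝ) - 1)) := by
          rw [mul_assoc, ← Real.rpow_add hn0, ← Real.rpow_add hn0]
          congr 2
          push_cast
          ring
      _ < r * b * (n : ℝ) ^ (((j + 1 : ℕ) : ℝ) / ((k : ℝ) - 1)) := by
          have := hone (j + 1)
          gcongr
      _ ≤ _ := by gcongr
  · intro i _ u
    rw [hlast]
    exact coordDegree_apEdges_le k n A i u
  · rwa [hlast]

/-- Each round removes `b * n` elements from every container still larger than `t`, so `s` rounds
suffice. -/
theorem covered_apFree_iterate (k n : ℕ) (hk : 2 ≤ k) (hn : 0 < n) (b : ℝ) (hb : 0 < b) (t : ℝ)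
    (hsat : ∀ A ⊆ Icc 1 n, t < A.card →
      b * (2 * k) ^ (k - 1) * n * n ≤ (apEdges k n A).card)
    (r : ℕ) (hr : 8 * (n : ℝ) ^ (1 - 1 / ((k : ℝ) - 1)) < r * b) (s : ℕ) (A : Finset ℕ)
    (hA : A ⊆ Icc 1 n) (hAs : A.card ≤ t + s * (b * n)) :
    Covered (fun I => IsAPFree k I ∧ I ⊆ A) (((n + 1) ^ (r * (k - 1))) ^ s) t := by
  induction s generalizing A with
  | zero =>
    rw [pow_zero]
    exact Covered.singleton A (by simpa using hAs) fun I hI => hI.2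
  | succ s ih =>
    by_cases ht : (A.card : ℝ) ≤ t
    · exact (Covered.singleton A ht fun I hI => hI.2).mono (fun _ h => h)
        (Nat.one_le_pow _ _ (by positivity)) le_rfl
    obtain ⟨𝒞, h1, h2, h3⟩ :=
      covered_apFree k n hk hn A hA b hb (hsat A hA (not_le.1 ht)) r hr
    have h4 : ∀ C ∈ 𝒞, Covered (fun I => IsAPFree k I ∧ I ⊆ C ∩ A)
        (((n + 1) ^ (r * (k - 1))) ^ s) t := by
      intro C hC
      -- `Covered` does not force `C ⊆ A`; intersecting keeps the container inside `[n]`.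
      refine ih (C ∩ A) (inter_subset_right.trans hA) ?_
      have h5 : ((C ∩ A).card : ℝ) ≤ C.card := by exact_mod_cast card_le_card inter_subset_left
      have := h2 C hC
      push_cast at hAs
      linarith
    refine (Covered.biUnion 𝒞 h4).mono ?_ ?_ le_rfl
    · rintro I ⟨hI, hIA⟩
      obtain ⟨C, hC, hIC⟩ := h3 I ⟨hI, hIA⟩
      exact ⟨C, hC, hI, subset_inter hIC hIA⟩
    · rw [pow_succ, mul_comm]
      exact Nat.mul_le_mul_left _ h1

/-! ### Supersaturation -/

theorem card_le_maxAPFree {k M : ℕ} {W : Finset ℕ} (hW : W ⊆ Icc 1 M) (h : IsAPFree k W) :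
    W.card ≤ maxAPFree k M :=
  le_sup (f := card) (by simp [apFreeSets, hW, h])

/-- The positions in `[M]` at which the progression `a + d, a + 2 * d, …` meets `A`. -/
def progressionTrace (A : Finset ℕ) (M : ℕ) (e : ℕ × ℕ) : Finset ℕ :=
  (Icc 1 M).filter (fun i => e.1 + i * e.2 ∈ A)

theorem card_le_card_shift_add (A : Finset ℕ) (n : ℕ) (hA : A ⊆ Icc 1 n) (q : ℕ) (hq : 0 < q) :
    A.card ≤ ((range n).filter (fun a => a + q ∈ A)).card + q := by
  have h1 : (A \ range q).card ≤ ((range n).filter (fun a => a + q ∈ A)).card := by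
    refine card_le_card_of_injOn (fun y => y - q) ?_ ?_
    · intro y hy
      obtain ⟨hyA, hyq⟩ := mem_sdiff.1 (mem_coe.1 hy)
      have h2 := mem_Icc.1 (hA hyA)
      rw [mem_range, not_lt] at hyq
      rw [mem_coe, mem_filter, mem_range]
      simp only
      rw [Nat.sub_add_cancel hyq]
      exact ⟨by omega, hyA⟩
    · intro y hy z hz h
      have h1 := (mem_sdiff.1 (mem_coe.1 hy)).2
      have h2 := (mem_sdiff.1 (mem_coe.1 hz)).2
      rw [mem_range, not_lt] at h1 h2
      simp only at h
      omega
  have h2 := le_card_sdiff (range q) A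
  rw [card_range] at h2
  omega

/-- Each shift by `i * d ≤ M * d` loses at most `|A| / 2` elements, so the traces have total size at
least `M * |A| / 2`. Poor shifts contribute at most `n * r_k(M) ≤ M * |A| / 4`, and a rich one at
most `M`. -/
theorem card_le_card_rich_shifts (k n M d : ℕ) (A : Finset ℕ) (hA : A ⊆ Icc 1 n) (hM : 0 < M)
    (hd : 0 < d) (hMd : 2 * (M * d) ≤ A.card) (hr : 4 * n * maxAPFree k M ≤ M * A.card) :
    A.card ≤
      4 * ((range n).filter (fun a => maxAPFree k M < (progressionTrace A M (a, d)).card)).card := by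
  set X := (range n).filter (fun a => maxAPFree k M < (progressionTrace A M (a, d)).card)
  have h1 : ∑ a ∈ range n, (progressionTrace A M (a, d)).card =
      ∑ i ∈ Icc 1 M, ((range n).filter (fun a => a + i * d ∈ A)).card :=
    sum_card_bipartiteAbove_eq_sum_card_bipartiteBelow (fun a i => a + i * d ∈ A)
  have h2 : M * A.card ≤ ∑ a ∈ range n, (progressionTrace A M (a, d)).card + M * (M * d) := by
    rw [h1]
    calc M * A.card = ∑ i ∈ Icc 1 M, A.card := by simp
      _ ≤ ∑ i ∈ Icc 1 M, (((range n).filter (fun a => a + i * d ∈ A)).card + M * d) := by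
          refine sum_le_sum fun i hi => ?_
          obtain ⟨hi1, hi2⟩ := mem_Icc.1 hi
          refine (card_le_card_shift_add A n hA (i * d) (Nat.mul_pos hi1 hd)).trans ?_
          gcongr
      _ = _ := by rw [sum_add_distrib]; simp
  have h3 : ∑ a ∈ range n, (progressionTrace A M (a, d)).card ≤
      M * X.card + n * maxAPFree k M := by
    rw [← sum_filter_add_sum_filter_not (range n)
      (fun a => maxAPFree k M < (progressionTrace A M (a, d)).card)]
    refine add_le_add ?_ ?_
    · rw [mul_comm, ← smul_eq_mul]
      refine sum_le_card_nsmul _ _ _ fun a _ => ?_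
      exact (card_filter_le _ _).trans (by simp)
    · refine (sum_le_card_nsmul _ _ (maxAPFree k M)
        fun a ha => not_lt.1 (mem_filter.1 ha).2).trans ?_
      rw [smul_eq_mul]
      exact Nat.mul_le_mul_right _ ((card_filter_le _ _).trans (by simp))
  refine Nat.le_of_mul_le_mul_left ?_ hM
  have h4 : 2 * (M * (M * d)) ≤ M * A.card := by
    calc 2 * (M * (M * d)) = M * (2 * (M * d)) := by ring
      _ ≤ _ := Nat.mul_le_mul_left _ hMd
  nlinarith

/-- Varnavides-type supersaturation: averaging over progressions of length `M`. -/
theorem card_mul_le_card_apEdges (k n M D : ℕ) (hk : 2 ≤ k) (A : Finset ℕ) (hA : A ⊆ Icc 1 n)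
    (hM : 0 < M) (hD : 2 * (M * D) ≤ A.card) (hr : 4 * n * maxAPFree k M ≤ M * A.card) :
    D * A.card ≤ 4 * (M ^ 2 * (apEdges k n A).card) := by
  set X := (range n ×ˢ Icc 1 D).filter
    (fun e => maxAPFree k M < (progressionTrace A M e).card) with hX
  have h1 : D * A.card ≤ 4 * X.card := by
    have h2 : X.card = ∑ d ∈ Icc 1 D, ((range n).filter
        (fun a => maxAPFree k M < (progressionTrace A M (a, d)).card)).card := by
      rw [hX, card_filter, sum_product_right]
      simp only [card_filter]
    rw [h2, mul_sum]
    calc D * A.card = ∑ d ∈ Icc 1 D, A.card := by simp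
      _ ≤ _ := sum_le_sum fun d hd => by
          obtain ⟨hd1, hd2⟩ := mem_Icc.1 hd
          exact card_le_card_rich_shifts k n M d A hA hM hd1
            (le_trans (by gcongr) hD) hr
  have h3 : ∀ e ∈ X, ∃ p : ℕ × ℕ, 0 < p.2 ∧ ∀ l < k, p.1 + l * p.2 ∈ progressionTrace A M e := by
    intro e he
    by_contra hcon
    refine (mem_filter.1 he).2.not_ge (card_le_maxAPFree (filter_subset _ _) ?_)
    rintro ⟨a, d, hd, h⟩
    exact hcon ⟨(a, d), hd, h⟩
  choose! p hp0 hp using h3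
  have h4 : X.card ≤ (apEdges k n A ×ˢ (Icc 1 M ×ˢ Icc 1 M)).card := by
    -- The `k`-AP in `A` together with its index pattern in `[M]` determines the long progression.
    refine card_le_card_of_injOn
      (fun e => ((e.1 + (p e).1 * e.2, (p e).2 * e.2), p e)) ?_ ?_
    · intro e he
      have hd : 0 < e.2 := (mem_Icc.1 (mem_product.1 (mem_filter.1 he).1).2).1
      have hmem : ∀ l < k, e.1 + (p e).1 * e.2 + l * ((p e).2 * e.2) ∈ A := by
        intro l hl
        have := (mem_filter.1 (hp e he l hl)).2
        rwa [show e.1 + ((p e).1 + l * (p e).2) * e.2 =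
          e.1 + (p e).1 * e.2 + l * ((p e).2 * e.2) by ring] at this
      have hI : ∀ l < k, (p e).1 + l * (p e).2 ∈ Icc 1 M := fun l hl =>
        (mem_filter.1 (hp e he l hl)).1
      have hI0 := mem_Icc.1 (hI 0 (by omega))
      have hI1 := mem_Icc.1 (hI 1 (by omega))
      have hA0 := mem_Icc.1 (hA (hmem 0 (by omega)))
      have hA1 := mem_Icc.1 (hA (hmem 1 (by omega)))
      have hpos : 0 < (p e).2 * e.2 := Nat.mul_pos (hp0 e he) hd
      have := hp0 e he
      simp only [zero_mul, one_mul, add_zero] at hI0 hI1 hA0 hA1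
      simp only [coe_product, Set.mem_prod, mem_coe, mem_Icc, apEdges, mem_filter, mem_product,
        mem_range]
      refine ⟨⟨⟨?_, ?_, ?_⟩, hmem⟩, ⟨?_, ?_⟩, ?_, ?_⟩ <;> omega
    · intro e he e' he' h
      simp only [Prod.mk.injEq] at h
      obtain ⟨⟨h1, h2⟩, h3⟩ := h
      rw [h3] at h1 h2
      have h4 : e.2 = e'.2 := Nat.eq_of_mul_eq_mul_left (hp0 e' he') h2
      rw [h4] at h1
      exact Prod.ext (by omega) h4
  rw [card_product, card_product, Nat.card_Icc] at h4
  calc D * A.card ≤ 4 * X.card := h1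
    _ ≤ 4 * ((apEdges k n A).card * (M * M)) := by simpa using Nat.mul_le_mul_left 4 h4
    _ = _ := by ring

/-! ### Passing from `n` to a small power of `n` -/

theorem iterate_sqrt_pow_le (t n : ℕ) : (Nat.sqrt^[t] n) ^ (2 ^ t) ≤ n := by
  induction t generalizing n with
  | zero => simp
  | succ t ih =>
    rw [Function.iterate_succ_apply, pow_succ, pow_mul]
    exact (Nat.pow_le_pow_left (ih _) 2).trans (Nat.sqrt_le' n)

theorem le_iterate_sqrt (t m n : ℕ) (h : m ^ (2 ^ t) ≤ n) : m ≤ Nat.sqrt^[t] n := by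
  induction t generalizing n with
  | zero => simpa using h
  | succ t ih =>
    rw [Function.iterate_succ_apply]
    rw [pow_succ, pow_mul] at h
    exact ih _ (Nat.le_sqrt'.2 h)

theorem IsDensityRate.le_iterate_sqrt {k n₀ : ℕ} {c K : ℝ} {h : ℕ → ℝ}
    (H : IsDensityRate k c K n₀ h) (t n : ℕ) (hn : n₀ ^ (2 ^ t) ≤ n) :
    h n ≤ (max K 1) ^ t * h (Nat.sqrt^[t] n) := by
  induction t generalizing n with
  | zero => simp
  | succ t ih =>
    rw [Function.iterate_succ_apply]
    rw [pow_succ, pow_mul] at hn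
    have h1 : n₀ ^ (2 ^ t) ≤ Nat.sqrt n := Nat.le_sqrt'.2 hn
    have h2 : n₀ ≤ Nat.sqrt n := (Nat.le_self_pow (by positivity) n₀).trans h1
    have h3 : (0 : ℝ) ≤ max K 1 := zero_le_one.trans (le_max_right _ _)
    calc h n ≤ K * h (Nat.sqrt n) := H.regular n h2
      _ ≤ max K 1 * h (Nat.sqrt n) := by
          have := (H.pos _ h2).le
          gcongr
          exact le_max_left _ _
      _ ≤ max K 1 * ((max K 1) ^ t * h (Nat.sqrt^[t] (Nat.sqrt n))) := by
          gcongr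
          exact ih _ h1
      _ = _ := by ring

theorem IsDensityRate.card_apEdges_ge {k n₀ : ℕ} {c K : ℝ} {h : ℕ → ℝ}
    (H : IsDensityRate k c K n₀ h) (hk : 2 ≤ k) (hn₀ : 0 < n₀) (t n : ℕ) (hn : n₀ ^ (2 ^ t) ≤ n)
    (A : Finset ℕ) (hA : A ⊆ Icc 1 n) (hAc : 4 * (max K 1) ^ t * n / h n < A.card)
    (hAM : 4 * Nat.sqrt^[t] n ≤ A.card) :
    (A.card : ℝ) ^ 2 ≤ 16 * (Nat.sqrt^[t] n : ℝ) ^ 3 * (apEdges k n A).card := by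
  set M := Nat.sqrt^[t] n with hM
  have hMn₀ : n₀ ≤ M := _root_.le_iterate_sqrt t n₀ n hn
  have hM0 : 0 < M := hn₀.trans_le hMn₀
  have hnn₀ : n₀ ≤ n := (Nat.le_self_pow (by positivity) n₀).trans hn
  have hhn := H.pos n hnn₀
  have hhM := H.pos M hMn₀
  have hMR : (0 : ℝ) < M := by exact_mod_cast hM0
  have hr : 4 * n * maxAPFree k M ≤ M * A.card := by
    have h1 : (4 * n * maxAPFree k M : ℝ) ≤ M * A.card := by
      calc (4 * n * maxAPFree k M : ℝ) ≤ 4 * n * (M / h M) := by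
            gcongr
            exact H.maxAPFree_le M hMn₀
        _ ≤ 4 * n * ((max K 1) ^ t * M / h n) := by
            gcongr 4 * (n : ℝ) * ?_
            rw [div_le_div_iff₀ hhM hhn]
            have := H.le_iterate_sqrt t n hn
            calc (M : ℝ) * h n ≤ M * ((max K 1) ^ t * h M) := by gcongr
              _ = _ := by ring
        _ = M * (4 * (max K 1) ^ t * n / h n) := by ring
        _ ≤ _ := by gcongr
    exact_mod_cast h1
  have h2 := card_mul_le_card_apEdges k n M (A.card / (2 * M)) hk A hA hM0
    (by rw [← mul_assoc]; exact Nat.mul_div_le _ _) hr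
  -- Rounding down `|A| / (2 * M)` loses at most a factor `2`, since `|A| ≥ 4 * M`.
  have h3 : A.card ≤ 4 * M * (A.card / (2 * M)) := by
    have e1 := Nat.div_add_mod A.card (2 * M)
    have e2 := Nat.mod_lt A.card (show 0 < 2 * M by omega)
    have e3 : 4 * M * (A.card / (2 * M)) = 2 * (2 * M * (A.card / (2 * M))) := by ring
    omega
  have h4 : A.card ^ 2 ≤ 16 * M ^ 3 * (apEdges k n A).card := by
    calc A.card ^ 2 = A.card * A.card := sq _
      _ ≤ 4 * M * (A.card / (2 * M)) * A.card := Nat.mul_le_mul_right _ h3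
      _ = 4 * M * (A.card / (2 * M) * A.card) := by ring
      _ ≤ 4 * M * (4 * (M ^ 2 * (apEdges k n A).card)) := Nat.mul_le_mul_left _ h2
      _ = _ := by ring
  exact_mod_cast h4

/-! ### Counting subsets of containers -/

/-- Absorbs the `2 ^ m` containers into the binomial coefficient; factor by factor, `2 * (N - i) ≤ 2
* N - i`. -/
theorem two_pow_mul_choose_le (N m : ℕ) : 2 ^ m * N.choose m ≤ (2 * N).choose m := by
  induction m with
  | zero => simp
  | succ m ih =>
    refine Nat.le_of_mul_le_mul_right ?_ (Nat.succ_pos m)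
    calc 2 ^ (m + 1) * N.choose (m + 1) * (m + 1)
        = 2 ^ (m + 1) * (N.choose (m + 1) * (m + 1)) := by ring
      _ = 2 ^ m * N.choose m * (2 * (N - m)) := by rw [Nat.choose_succ_right_eq]; ring
      _ ≤ (2 * N).choose m * (2 * N - m) := Nat.mul_le_mul ih (by omega)
      _ = _ := (Nat.choose_succ_right_eq _ _).symm

theorem card_filter_card_eq_le_of_covered {V : Type*} [DecidableEq V] {P : Finset V → Prop} {B : ℕ}
    {t : ℝ} (h : Covered P B t) (𝓢 : Finset (Finset V)) (h𝓢 : ∀ I ∈ 𝓢, P I) (m : ℕ) :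
    (𝓢.filter (fun I => I.card = m)).card ≤ B * ⌊t⌋₊.choose m := by
  obtain ⟨𝒞, h1, h2, h3⟩ := h
  calc (𝓢.filter (fun I => I.card = m)).card ≤ (𝒞.biUnion (powersetCard m)).card := by
        refine card_le_card fun I hI => ?_
        obtain ⟨hI, hIm⟩ := mem_filter.1 hI
        obtain ⟨C, hC, hIC⟩ := h3 I (h𝓢 I hI)
        exact mem_biUnion.2 ⟨C, hC, mem_powersetCard.2 ⟨hIC, hIm⟩⟩
    _ ≤ 𝒞.card * ⌊t⌋₊.choose m := card_biUnion_le_card_mul _ _ _ fun C hC => by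
        rw [card_powersetCard]
        exact Nat.choose_le_choose m (Nat.le_floor (h2 C hC))
    _ ≤ _ := Nat.mul_le_mul_right _ h1

theorem card_le_of_covered {V : Type*} [DecidableEq V] {P : Finset V → Prop} {B : ℕ} {t : ℝ}
    (h : Covered P B t) (𝓢 : Finset (Finset V)) (h𝓢 : ∀ I ∈ 𝓢, P I) :
    𝓢.card ≤ B * 2 ^ ⌊t⌋₊ := by
  obtain ⟨𝒞, h1, h2, h3⟩ := h
  calc 𝓢.card ≤ (𝒞.biUnion powerset).card := by
        refine card_le_card fun I hI => ?_
        obtain ⟨C, hC, hIC⟩ := h3 I (h𝓢 I hI)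
        exact mem_biUnion.2 ⟨C, hC, mem_powerset.2 hIC⟩
    _ ≤ 𝒞.card * 2 ^ ⌊t⌋₊ := card_biUnion_le_card_mul _ _ _ fun C hC => by
        rw [card_powerset]
        exact Nat.pow_le_pow_right two_pos (Nat.le_floor (h2 C hC))
    _ ≤ _ := Nat.mul_le_mul_right _ h1

/-! ### Choice of parameters -/

theorem eventually_logb_rpow_le (c ε : ℝ) (hε : 0 < ε) :
    ∀ᶠ n : ℕ in Filter.atTop, (Real.logb 2 (n : ℝ)) ^ c ≤ (n : ℝ) ^ ε := by
  have h2 : (0 : ℝ) < Real.log 2 := Real.log_pos one_lt_two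
  have h1 := (isLittleO_log_rpow_rpow_atTop c hε).bound (Real.rpow_pos_of_pos h2 c)
  filter_upwards [tendsto_natCast_atTop_atTop.eventually h1, Filter.eventually_ge_atTop 1]
    with n hn hn1
  have hlog : 0 ≤ Real.log (n : ℝ) := Real.log_natCast_nonneg n
  rw [Real.norm_of_nonneg (by positivity), Real.norm_of_nonneg (by positivity)] at hn
  rw [Real.logb, Real.div_rpow hlog h2.le, div_le_iff₀ (by positivity)]
  linarith

/-- With `X = n ^ ε`, supersaturation gives at least `n ^ 2 / (16 * X ^ 5)` progressions, and one
more `X` absorbs constants, so `b = X ^ (-6)`. The exponent `14` is `6` from `r`, `6` from the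
number of rounds `s`, `1` from the logarithm and `1` from the constant `36 * k`. -/
theorem IsDensityRate.covered_apFree {k n₀ : ℕ} {c K : ℝ} {h : ℕ → ℝ}
    (H : IsDensityRate k c K n₀ h) (hk : 2 ≤ k) (hn₀ : 2 ≤ n₀) (ε : ℝ) (hε : 0 < ε)
    (hε' : 14 * ε ≤ 1) (t n : ℕ) (ht : 1 ≤ ε * 2 ^ t) (hn : n₀ ^ (2 ^ t) ≤ n)
    (hlogc : (Real.logb 2 (n : ℝ)) ^ c ≤ (n : ℝ) ^ ε) (hlog : Real.logb 2 (n : ℝ) ≤ (n : ℝ) ^ ε)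
    (hX1 : 16 * (2 * (k : ℝ)) ^ (k - 1) ≤ (n : ℝ) ^ ε) (hX2 : 36 * (k : ℝ) ≤ (n : ℝ) ^ ε)
    (m : ℕ) (hm : (n : ℝ) ^ (1 - 1 / ((k : ℝ) - 1) + 14 * ε) ≤ m) :
    Covered (fun I => IsAPFree k I ∧ I ⊆ Icc 1 n) (2 ^ m) (4 * (max K 1) ^ t * n / h n) := by
  have hnn₀ : n₀ ≤ n := (Nat.le_self_pow (by positivity) n₀).trans hn
  have hn2 : 2 ≤ n := hn₀.trans hnn₀
  have hnR : (2 : ℝ) ≤ n := by exact_mod_cast hn2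
  have hn0 : (0 : ℝ) < n := by linarith
  have hkR : (2 : ℝ) ≤ k := by exact_mod_cast hk
  have hhn := H.pos n hnn₀
  have hhX : h n ≤ (n : ℝ) ^ ε := (H.le_log_rpow n hnn₀).trans hlogc
  have hX14 : ((n : ℝ) ^ ε) ^ 14 = (n : ℝ) ^ (14 * ε) := by
    rw [← Real.rpow_natCast, ← Real.rpow_mul hn0.le, mul_comm]
    norm_num
  have hX14n : ((n : ℝ) ^ ε) ^ 14 ≤ n := by
    rw [hX14]
    simpa using Real.rpow_le_rpow_of_exponent_le (by linarith : (1 : ℝ) ≤ n) hε'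
  have hMX : (Nat.sqrt^[t] n : ℝ) ≤ (n : ℝ) ^ ε := by
    have h1 : (Nat.sqrt^[t] n : ℝ) ^ (2 ^ t) ≤ n := by exact_mod_cast iterate_sqrt_pow_le t n
    refine le_of_pow_le_pow_left₀ (n := 2 ^ t) (by positivity) (by positivity) (h1.trans ?_)
    rw [← Real.rpow_natCast, ← Real.rpow_mul hn0.le]
    push_cast
    simpa using Real.rpow_le_rpow_of_exponent_le (by linarith : (1 : ℝ) ≤ n) ht
  rw [Real.rpow_add hn0, ← hX14] at hm
  have hY1 : (1 : ℝ) ≤ (n : ℝ) ^ (1 - 1 / ((k : ℝ) - 1)) := by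
    refine Real.one_le_rpow (by linarith) (sub_nonneg.2 ?_)
    rw [div_le_one (by linarith)]
    linarith
  set X : ℝ := (n : ℝ) ^ ε with hX
  set Y : ℝ := (n : ℝ) ^ (1 - 1 / ((k : ℝ) - 1)) with hY
  have hX4 : 4 ≤ X := by linarith
  have hX0 : 0 < X := by linarith
  set T : ℝ := 4 * (max K 1) ^ t * n / h n with hT
  have hTn : n / X ≤ T := by
    rw [hT, div_le_div_iff₀ hX0 hhn]
    have h1 : (1 : ℝ) ≤ (max K 1) ^ t := one_le_pow₀ (le_max_right _ _)
    calc (n : ℝ) * h n ≤ n * X := by gcongr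
      _ ≤ (4 * (max K 1) ^ t) * (n * X) := le_mul_of_one_le_left (by positivity) (by linarith)
      _ = _ := by ring
  have hsat : ∀ A ⊆ Icc 1 n, T < A.card →
      1 / X ^ 6 * (2 * k) ^ (k - 1) * n * n ≤ (apEdges k n A).card := by
    intro A hA hTA
    have hAX : n ≤ A.card * X := (div_le_iff₀ hX0).1 (hTn.trans hTA.le)
    have hAM : 4 * Nat.sqrt^[t] n ≤ A.card := by
      have h1 : (4 * Nat.sqrt^[t] n : ℝ) ≤ A.card := by
        refine le_trans ?_ (hTn.trans hTA.le)
        rw [le_div_iff₀ hX0]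
        calc 4 * (Nat.sqrt^[t] n : ℝ) * X ≤ X * X * X := by gcongr
          _ = X ^ 3 := by ring
          _ ≤ X ^ 14 := pow_le_pow_right₀ (by linarith) (by norm_num)
          _ ≤ n := hX14n
      exact_mod_cast h1
    have h1 := H.card_apEdges_ge hk (by omega) t n hn A hA hTA hAM
    have h2 : (n : ℝ) * n ≤ 16 * X ^ 5 * (apEdges k n A).card := by
      calc (n : ℝ) * n ≤ (A.card * X) * (A.card * X) := by gcongr
        _ = (A.card : ℝ) ^ 2 * X ^ 2 := by ring
        _ ≤ (16 * (Nat.sqrt^[t] n : ℝ) ^ 3 * (apEdges k n A).card) * X ^ 2 := by gcongr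
        _ ≤ (16 * X ^ 3 * (apEdges k n A).card) * X ^ 2 := by gcongr
        _ = _ := by ring
    calc 1 / X ^ 6 * (2 * k) ^ (k - 1) * n * n = (2 * k) ^ (k - 1) * (n * n) / X ^ 6 := by
          rw [one_div_mul_eq_div]; ring
      _ ≤ ((apEdges k n A).card : ℝ) := by
          rw [div_le_iff₀ (by positivity)]
          calc (2 * (k : ℝ)) ^ (k - 1) * (n * n)
              ≤ (2 * k) ^ (k - 1) * (16 * X ^ 5 * (apEdges k n A).card) := by gcongr
            _ = (16 * (2 * k) ^ (k - 1)) * X ^ 5 * (apEdges k n A).card := by ring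
            _ ≤ X * X ^ 5 * (apEdges k n A).card := by gcongr
            _ = _ := by ring
  have hX6 : 1 ≤ X ^ 6 := one_le_pow₀ (by linarith)
  set r : ℕ := ⌊8 * Y * X ^ 6⌋₊ + 1 with hr
  set s : ℕ := ⌈X ^ 6⌉₊ with hs
  have hr1 : 8 * Y * X ^ 6 < r := by
    rw [hr, Nat.cast_add_one]
    exact Nat.lt_floor_add_one _
  have hr2 : (r : ℝ) ≤ 9 * Y * X ^ 6 := by
    have h1 : (⌊8 * Y * X ^ 6⌋₊ : ℝ) ≤ 8 * Y * X ^ 6 := Nat.floor_le (by positivity)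
    have h2 : 1 ≤ Y * X ^ 6 := by nlinarith
    rw [hr]
    push_cast
    linarith
  have hs1 : X ^ 6 ≤ s := Nat.le_ceil _
  have hs2 : (s : ℝ) ≤ 2 * X ^ 6 := by
    have := Nat.ceil_lt_add_one (zero_le_one.trans hX6)
    linarith
  refine (covered_apFree_iterate k n hk (by omega) (1 / X ^ 6) (by positivity) T hsat r ?_ s
    (Icc 1 n) subset_rfl ?_).mono (fun _ h => h) ?_ le_rfl
  · rwa [mul_one_div, lt_div_iff₀ (by positivity)]
  · have h1 : (n : ℝ) ≤ s * (1 / X ^ 6 * n) := by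
      rw [← mul_assoc, mul_one_div]
      refine le_mul_of_one_le_left hn0.le ?_
      rwa [le_div_iff₀ (by positivity), one_mul]
    have h2 : 0 ≤ T := le_trans (by positivity) hTn
    rw [Nat.card_Icc, Nat.add_sub_cancel]
    linarith
  · rw [← pow_mul]
    have hl0 : 0 ≤ Real.logb 2 (n : ℝ) := Real.logb_nonneg one_lt_two (by linarith)
    have h1 : ((n : ℝ) + 1) ≤ (2 : ℝ) ^ (2 * Real.logb 2 (n : ℝ)) := by
      rw [mul_comm, Real.rpow_mul two_pos.le, Real.rpow_logb two_pos (by norm_num) hn0,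
        Real.rpow_two]
      nlinarith
    have h2 : 2 * Real.logb 2 (n : ℝ) * ((r * (k - 1) * s : ℕ) : ℝ) ≤ m := by
      have h3 : ((k - 1 : ℕ) : ℝ) ≤ k := by exact_mod_cast Nat.sub_le k 1
      push_cast
      calc 2 * Real.logb 2 (n : ℝ) * (r * ((k - 1 : ℕ) : ℝ) * s)
          ≤ 2 * X * ((9 * Y * X ^ 6) * k * (2 * X ^ 6)) := by gcongr
        _ = (36 * k) * (Y * X ^ 13) := by ring
        _ ≤ X * (Y * X ^ 13) := by gcongr
        _ = Y * X ^ 14 := by ring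
        _ ≤ m := hm
    have h4 : ((n : ℝ) + 1) ^ (r * (k - 1) * s) ≤ 2 ^ m := by
      calc ((n : ℝ) + 1) ^ (r * (k - 1) * s)
          ≤ ((2 : ℝ) ^ (2 * Real.logb 2 (n : ℝ))) ^ (r * (k - 1) * s) := by gcongr
        _ = (2 : ℝ) ^ (2 * Real.logb 2 (n : ℝ) * ((r * (k - 1) * s : ℕ) : ℝ)) := by
            rw [← Real.rpow_natCast, ← Real.rpow_mul two_pos.le]
        _ ≤ (2 : ℝ) ^ (m : ℝ) := Real.rpow_le_rpow_of_exponent_le one_le_two h2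
        _ = 2 ^ m := Real.rpow_natCast _ _
    exact_mod_cast h4

/-- Uniformly over all density rates, the `k`-AP-free subsets of `[n]` lie in few containers. -/
theorem exists_covered_apFree (k : ℕ) (hk : 2 ≤ k) (c K : ℝ) (n₀ : ℕ) (hn₀ : 2 ≤ n₀) (γ : ℝ)
    (hγ : 0 < γ) : ∃ C : ℝ, 1 ≤ C ∧ ∀ᶠ n : ℕ in Filter.atTop, ∀ h : ℕ → ℝ,
      IsDensityRate k c K n₀ h → ∀ m : ℕ, (n : ℝ) ^ (1 - 1 / ((k : ℝ) - 1) + γ) ≤ m →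
        Covered (fun I => IsAPFree k I ∧ I ⊆ Icc 1 n) (2 ^ m) (C * n / h n) := by
  set ε : ℝ := min γ 1 / 14 with hε
  have hε0 : 0 < ε := by positivity
  have hε1 : 14 * ε ≤ 1 := by
    have := min_le_right γ 1
    linarith
  have hεγ : 14 * ε ≤ γ := by
    have := min_le_left γ 1
    linarith
  obtain ⟨t, ht⟩ := pow_unbounded_of_one_lt (1 / ε) one_lt_two
  have ht' : 1 ≤ ε * 2 ^ t := by
    rw [div_lt_iff₀ hε0] at ht
    linarith
  refine ⟨4 * (max K 1) ^ t, ?_, ?_⟩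
  · have : (1 : ℝ) ≤ (max K 1) ^ t := one_le_pow₀ (le_max_right _ _)
    linarith
  have hpow : Filter.Tendsto (fun n : ℕ => (n : ℝ) ^ ε) Filter.atTop Filter.atTop :=
    (tendsto_rpow_atTop hε0).comp tendsto_natCast_atTop_atTop
  filter_upwards [Filter.eventually_ge_atTop (n₀ ^ (2 ^ t)), Filter.eventually_ge_atTop 1,
    eventually_logb_rpow_le c ε hε0, eventually_logb_rpow_le 1 ε hε0,
    hpow.eventually_ge_atTop (16 * (2 * (k : ℝ)) ^ (k - 1)),
    hpow.eventually_ge_atTop (36 * (k : ℝ))] with n h1 h2 h3 h4 h5 h6 h H m hm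
  rw [Real.rpow_one] at h4
  refine H.covered_apFree hk hn₀ ε hε0 hε1 t n ht' h1 h3 h4 h5 h6 m (le_trans ?_ hm)
  exact Real.rpow_le_rpow_of_exponent_le (by exact_mod_cast h2) (by linarith)

/-! ### The two counting bounds -/

theorem mem_apFreeSets {k n : ℕ} {A : Finset ℕ} :
    A ∈ apFreeSets k n ↔ IsAPFree k A ∧ A ⊆ Icc 1 n := by
  simp [apFreeSets, and_comm]

theorem apFreeSets_subset (k n : ℕ) : apFreeSets k n ⊆ (Icc 1 n).powerset := fun _ hA =>
  mem_powerset.2 (mem_apFreeSets.1 hA).2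

theorem IsDensityRate.le_of_lt {k n₀ : ℕ} {c K : ℝ} {h : ℕ → ℝ}
    (H : IsDensityRate k c K n₀ h) (hc : 0 < c) (hn₀ : 2 ≤ n₀) {n N : ℕ} (hn : n₀ ≤ n)
    (hnN : n < N) : h n ≤ (Real.logb 2 (N : ℝ)) ^ c := by
  have h2 : (2 : ℝ) ≤ n := by exact_mod_cast hn₀.trans hn
  refine (H.le_log_rpow n hn).trans ?_
  refine Real.rpow_le_rpow (Real.logb_nonneg one_lt_two (by linarith)) ?_ hc.le
  exact Real.logb_le_logb_of_le one_lt_two (by linarith) (by exact_mod_cast hnN.le)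

theorem theorem1p4 (k : ℕ) (hk : 3 ≤ k) (c : ℝ) (hc : 0 < c) (K : ℝ) (n₀ : ℕ) (hn₀ : 2 ≤ n₀) :
    (∃ C : ℝ, 0 < C ∧ ∀ h : ℕ → ℝ, IsDensityRate k c K n₀ h → ∀ n : ℕ, n₀ ≤ n →
      ((apFreeSets k n).card : ℝ) ≤ (2 : ℝ) ^ (C * ((n : ℝ) / h n))) ∧
    (∀ γ : ℝ, 0 < γ →
      ∃ C : ℝ, 0 < C ∧ ∀ h : ℕ → ℝ, IsDensityRate k c K n₀ h → ∀ n : ℕ, n₀ ≤ n →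
        ∀ m : ℕ, (n : ℝ) ^ (1 - 1 / ((k : ℝ) - 1) + γ) ≤ (m : ℝ) →
          ((apFreeSets k n).filter (fun A => A.card = m)).card ≤
            Nat.choose ⌊C * (n : ℝ) / h n⌋₊ m) := by
  have hk2 : 2 ≤ k := by omega
  refine ⟨?_, fun γ hγ => ?_⟩
  · have hkR : (3 : ℝ) ≤ k := by exact_mod_cast hk
    -- This makes the container exponent `1 - γ`; as `h n ≤ n ^ γ` for large `n`, the containers
    -- number at most `2 ^ ⌈n ^ (1 - γ)⌉₊`, with `n ^ (1 - γ) ≤ n / h n`.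
    set γ : ℝ := 1 / (2 * ((k : ℝ) - 1)) with hγ
    have hγ0 : 0 < γ := by
      have : (0 : ℝ) < k - 1 := by linarith
      positivity
    have hγ1 : γ ≤ 1 := by
      rw [hγ, div_le_one (by linarith)]
      linarith
    have hexp : 1 - 1 / ((k : ℝ) - 1) + γ = 1 - γ := by
      have : (k : ℝ) - 1 ≠ 0 := by linarith
      rw [hγ]
      field_simp
      ring
    obtain ⟨C, hC, hev⟩ := exists_covered_apFree k hk2 c K n₀ hn₀ γ hγ0
    obtain ⟨N, hN⟩ := Filter.eventually_atTop.1 (hev.and (eventually_logb_rpow_le c γ hγ0))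
    -- The second entry handles `n < N`: there `h n ≤ (log₂ N) ^ c`, so the trivial bound `2 ^ n`
    -- suffices.
    refine ⟨max (C + 2) ((Real.logb 2 (N : ℝ)) ^ c), lt_max_of_lt_left (by linarith),
      fun h H n hn => ?_⟩
    have hh := H.pos n hn
    have hn1 : (1 : ℝ) ≤ n := by exact_mod_cast (by omega : 1 ≤ n)
    have hn0 : (0 : ℝ) < n := by linarith
    rcases lt_or_ge n N with hnN | hnN
    · have h1 : ((apFreeSets k n).card : ℝ) ≤ 2 ^ n := by
        have := card_le_card (apFreeSets_subset k n)
        rw [card_powerset, Nat.card_Icc, Nat.add_sub_cancel] at this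
        exact_mod_cast this
      rw [← Real.rpow_natCast] at h1
      refine h1.trans (Real.rpow_le_rpow_of_exponent_le one_le_two ?_)
      rw [← mul_div_assoc, le_div_iff₀ hh, mul_comm]
      gcongr
      exact (H.le_of_lt hc hn₀ hn hnN).trans (le_max_right _ _)
    · obtain ⟨hcov, hlog⟩ := hN n hnN
      have hhγ : h n ≤ (n : ℝ) ^ γ := (H.le_log_rpow n hn).trans hlog
      set Z : ℝ := (n : ℝ) ^ (1 - γ) with hZ
      have hZ1 : 1 ≤ Z := Real.one_le_rpow hn1 (by linarith)
      have hZh : Z ≤ n / h n := by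
        rw [le_div_iff₀ hh]
        calc Z * h n ≤ Z * (n : ℝ) ^ γ := by gcongr
          _ = n := by rw [hZ, ← Real.rpow_add hn0, sub_add_cancel, Real.rpow_one]
      have h1 := card_le_of_covered (hcov h H ⌈Z⌉₊ (by rw [hexp]; exact Nat.le_ceil _))
        (apFreeSets k n) (fun I hI => mem_apFreeSets.1 hI)
      rw [← pow_add] at h1
      have h2 : ((apFreeSets k n).card : ℝ) ≤ (2 : ℝ) ^ ((⌈Z⌉₊ + ⌊C * n / h n⌋₊ : ℕ) : ℝ) := by
        rw [Real.rpow_natCast]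
        exact_mod_cast h1
      refine h2.trans (Real.rpow_le_rpow_of_exponent_le one_le_two ?_)
      have h3 := Nat.ceil_lt_add_one (zero_le_one.trans hZ1)
      have h4 : (⌊C * n / h n⌋₊ : ℝ) ≤ C * n / h n := Nat.floor_le (by positivity)
      push_cast
      calc (⌈Z⌉₊ : ℝ) + ⌊C * n / h n⌋₊ ≤ 2 * (n / h n) + C * n / h n := by linarith
        _ = (C + 2) * (n / h n) := by ring
        _ ≤ _ := by
          gcongr
          exact le_max_left _ _
  · obtain ⟨C, hC, hev⟩ := exists_covered_apFree k hk2 c K n₀ hn₀ γ hγ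
    obtain ⟨N, hN⟩ := Filter.eventually_atTop.1 hev
    refine ⟨max (2 * C) ((Real.logb 2 (N : ℝ)) ^ c), lt_max_of_lt_left (by linarith),
      fun h H n hn m hm => ?_⟩
    have hh := H.pos n hn
    rcases lt_or_ge n N with hnN | hnN
    · calc _ ≤ (powersetCard m (Icc 1 n)).card := by
            refine card_le_card fun A hA => ?_
            obtain ⟨hA, hAm⟩ := mem_filter.1 hA
            exact mem_powersetCard.2 ⟨(mem_apFreeSets.1 hA).2, hAm⟩
        _ = n.choose m := by rw [card_powersetCard, Nat.card_Icc, Nat.add_sub_cancel]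
        _ ≤ _ := Nat.choose_le_choose m (Nat.le_floor (by
            rw [le_div_iff₀ hh, mul_comm]
            gcongr
            exact (H.le_of_lt hc hn₀ hn hnN).trans (le_max_right _ _)))
    · calc _ ≤ 2 ^ m * ⌊C * n / h n⌋₊.choose m :=
            card_filter_card_eq_le_of_covered (hN n hnN h H m hm) _
              (fun I hI => mem_apFreeSets.1 hI) m
        _ ≤ (2 * ⌊C * n / h n⌋₊).choose m := two_pow_mul_choose_le _ _
        _ ≤ _ := Nat.choose_le_choose m (Nat.le_floor (by
            have h1 : (⌊C * n / h n⌋₊ : ℝ) ≤ C * n / h n := Nat.floor_le (by positivity)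
            push_cast
            calc 2 * (⌊C * n / h n⌋₊ : ℝ) ≤ 2 * (C * n / h n) := by gcongr
              _ = (2 * C) * n / h n := by ring
              _ ≤ _ := by
                gcongr
                exact le_max_left _ _))
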